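/- A $2$-copula is a function $C\colon[0,1]^2\to\mathbb{R}$ with $C(0,v)=C(u,0)=0$, $C(1,v)=v$, $C(u,1)=u$ for all $u,v\in[0,1]$ and $C(u_2,v_2)-C(u_2,v_1)-C(u_1,v_2)+C(u_1,v_1)\ge 0$ whenever $0\le u_1\le u_2\le 1$ and $0\le v_1\le v_2\le 1$. A $2$-copula $C$ is called stochastically increasing (decreasing) in the first component if, for every $v\in[0,1]$, there is a Lebesgue null set outside of which the partial derivative $u\mapsto\partial_1 C(u,v)$ exists and is non-increasing (non-decreasing) on $[0,1]$; it is called stochastically monotone in the first component if it is stochastically increasing or stochastically decreasing in the first component. The Markov product of two $2$-copulas $C_1,C_2$ is $$(C_1*C_2)(u,v)=\int_0^1\partial_2C_1(u,t)\,\partial_1C_2(t,v)\,dt ,\qquad u,v\in[0,1].$$ Suppose that the $2$-copulas $C_1$ and $C_2$ are stochastically monotone in the first component. Then $C_1*C_2$ is again a $2$-copula that is stochastically monotone in the first component. More precisely, $C_1*C_2$ is 1. stochastically increasing in the first component if $C_1$ and $C_2$ are both stochastically increasing or both stochastically decreasing in the first component; 2. stochastically decreasing in the first component if one of $C_1,C_2$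 is stochastically increasing and the other is stochastically decreasing in the first component. -/

import Mathlib

open MeasureTheory Set

/-- `C` restricted to `[0,1]²` is a `2`-copula, i.e. a bivariate distribution function on `[0,1]²`
with uniform margins: grounded, with identity margins, and `2`-increasing. Only the values of `C`
on `[0,1]²` are relevant, here and in all the definitions below. -/
structure IsCopula (C : ℝ → ℝ → ℝ) : Prop where
  zero_left : ∀ v ∈ Icc (0 : ℝ) 1, C 0 v = 0
  zero_right : ∀ u ∈ Icc (0 : ℝ) 1, C u 0 = 0
  one_left : ∀ v ∈ Icc (0 : ℝ) 1, C 1 v = v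
  one_right : ∀ u ∈ Icc (0 : ℝ) 1, C u 1 = u
  two_increasing : ∀ u₁ ∈ Icc (0 : ℝ) 1, ∀ u₂ ∈ Icc (0 : ℝ) 1,
    ∀ v₁ ∈ Icc (0 : ℝ) 1, ∀ v₂ ∈ Icc (0 : ℝ) 1, u₁ ≤ u₂ → v₁ ≤ v₂ →
      0 ≤ C u₂ v₂ - C u₂ v₁ - C u₁ v₂ + C u₁ v₁

/-- The partial derivative `∂₁ C (u, v)` in `[0,1]` (one-sided at the end points). -/
noncomputable def copulaPartialFst (C : ℝ → ℝ → ℝ) (u v : ℝ) : ℝ :=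
  derivWithin (fun s : ℝ => C s v) (Icc 0 1) u

/-- The partial derivative `∂₂ C (u, v)` in `[0,1]` (one-sided at the end points). -/
noncomputable def copulaPartialSnd (C : ℝ → ℝ → ℝ) (u v : ℝ) : ℝ :=
  derivWithin (fun t : ℝ => C u t) (Icc 0 1) v

/-- The Markov product `(C₁ * C₂)(u, v) = ∫₀¹ ∂₂ C₁(u, t) ∂₁ C₂(t, v) dt`. -/
noncomputable def markovProduct (C₁ C₂ : ℝ → ℝ → ℝ) (u v : ℝ) : ℝ :=
  ∫ t in (0 : ℝ)..1, copulaPartialSnd C₁ u t * copulaPartialFst C₂ t v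

/-- Stochastically increasing in the first component: for every `v ∈ [0,1]`, the partial derivative
`u ↦ ∂₁ C(u, v)` exists and is (weakly) decreasing outside a null set of points `u ∈ [0,1]`. -/
def StochasticallyIncreasing (C : ℝ → ℝ → ℝ) : Prop :=
  ∀ v ∈ Icc (0 : ℝ) 1, ∃ N : Set ℝ, volume N = 0 ∧
    (∀ u ∈ Icc (0 : ℝ) 1 \ N, DifferentiableWithinAt ℝ (fun s : ℝ => C s v) (Icc 0 1) u) ∧
    AntitoneOn (fun u : ℝ => copulaPartialFst C u v) (Icc 0 1 \ N)

/-- Stochastically decreasing in the first component: for every `v ∈ [0,1]`, the partial derivative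
`u ↦ ∂₁ C(u, v)` exists and is (weakly) increasing outside a null set of points `u ∈ [0,1]`. -/
def StochasticallyDecreasing (C : ℝ → ℝ → ℝ) : Prop :=
  ∀ v ∈ Icc (0 : ℝ) 1, ∃ N : Set ℝ, volume N = 0 ∧
    (∀ u ∈ Icc (0 : ℝ) 1 \ N, DifferentiableWithinAt ℝ (fun s : ℝ => C s v) (Icc 0 1) u) ∧
    MonotoneOn (fun u : ℝ => copulaPartialFst C u v) (Icc 0 1 \ N)

/-- Stochastically monotone in the first component. -/
def StochasticallyMonotone (C : ℝ → ℝ → ℝ) : Prop :=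
  StochasticallyIncreasing C ∨ StochasticallyDecreasing C

/-! For a copula, `s ↦ C s v` is Lipschitz, hence the integral of its a.e. derivative; so
stochastically decreasing (increasing) means convex (concave) in the first argument. Choose signs σ,
τ making σC₁ and τC₂ convex in the first argument. For z = ax + by put h(t) = σ(a C₁(x,t) + b
C₁(y,t) - C₁(z,t)). Then h ≥ 0, and h vanishes at t = 0 and t = 1. The convexity defect of -στ(C₁ *
C₂)(·,v) is -∫ h' G with G = τ ∂₁C₂(·,v) increasing a.e.; integration by parts turns this into ∫ h
dG ≥ 0 (`integral_deriv_mul_antitone_nonneg`). `IsCopula.convexOn_markovProduct` thus settles all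
four sign cases at once. -/

/-! ### Integration by parts against a monotone function -/

/-- A Lipschitz function vanishing off `[0,1]` has bounded range. -/
lemma LipschitzWith.abs_le_of_eq_zero_off {K : NNReal} {h : ℝ → ℝ} (hL : LipschitzWith K h)
    (h₀ : ∀ t ≤ 0, h t = 0) (h₁ : ∀ t, 1 ≤ t → h t = 0) (t : ℝ) : ‖h t‖ ≤ K := by
  rcases le_total t 0 with ht | ht
  · simp [h₀ t ht]
  rcases le_total 1 t with ht' | ht'
  · simp [h₁ t ht']
  have := hL.norm_sub_le t 0
  rw [h₀ 0 le_rfl, sub_zero, sub_zero, Real.norm_of_nonneg ht] at this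
  exact this.trans (mul_le_of_le_one_right K.2 ht')

/-- If `h ≥ 0` is Lipschitz and vanishes off `[0,1]`, and `G` is decreasing, then
`∫₀¹ h' G = - ∫₀¹ h dG ≥ 0`. -/
theorem integral_deriv_mul_antitone_nonneg {K : NNReal} {h G : ℝ → ℝ} (hL : LipschitzWith K h)
    (hpos : ∀ t, 0 ≤ h t) (h₀ : ∀ t ≤ 0, h t = 0) (h₁ : ∀ t, 1 ≤ t → h t = 0)
    (hG : Antitone G) : 0 ≤ ∫ t in (0 : ℝ)..1, deriv h t * G t := by
  -- Truncation makes `G` integrable; the margin around [0,1] keeps x - ε inside the window for x ∈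
  -- [0,1] and ε < 1.
  set g : ℝ → ℝ := (Icc (-1 : ℝ) 2).indicator G with hg
  have hgi : Integrable g :=
    (integrable_indicator_iff measurableSet_Icc).2
      ((hG.antitoneOn _).integrableOn_isCompact isCompact_Icc)
  have hlim := hL.integral_inv_smul_sub_mul_tendsto_integral_lineDeriv_mul (μ := volume) hgi 1
  have hderiv : ∀ x, lineDeriv ℝ h x 1 = deriv h x := fun x => by
    simp only [lineDeriv, smul_eq_mul, mul_one]
    rw [deriv_comp_const_add, add_zero]
  have hint : ∫ x, lineDeriv ℝ h x 1 * g x = ∫ t in (0 : ℝ)..1, deriv h t * G t := by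
    rw [intervalIntegral.integral_of_le zero_le_one, ← integral_Icc_eq_integral_Ioc,
      ← integral_indicator measurableSet_Icc]
    congr 1 with x
    rw [hderiv]
    by_cases hx : x ∈ Icc (0 : ℝ) 1
    · rw [indicator_of_mem hx, hg, indicator_of_mem (by constructor <;> linarith [hx.1, hx.2])]
    · rw [indicator_of_notMem hx]
      have : deriv h x = 0 := by
        have hev : h =ᶠ[nhds x] fun _ => 0 := by
          rw [mem_Icc, not_and_or, not_le, not_le] at hx
          rcases hx with hx | hx
          · filter_upwards [Iio_mem_nhds hx] with y hy using h₀ y (le_of_lt hy)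
          · filter_upwards [Ioi_mem_nhds hx] with y hy using h₁ y (le_of_lt hy)
        rw [hev.deriv_eq, deriv_const]
      rw [this, zero_mul]
  rw [← hint]
  refine ge_of_tendsto hlim ?_
  filter_upwards [Ioo_mem_nhdsGT (zero_lt_one (α := ℝ))] with ε hε
  have hhm : AEStronglyMeasurable h := hL.continuous.aestronglyMeasurable
  have hbd := hL.abs_le_of_eq_zero_off h₀ h₁
  have i₁ : Integrable fun x => h x * g x := hgi.bdd_mul hhm (ae_of_all _ hbd)
  have i₂ : Integrable fun x => h (x + ε) * g x :=
    hgi.bdd_mul (hL.continuous.comp (continuous_add_const ε)).aestronglyMeasurable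
      (ae_of_all _ fun x => hbd _)
  have i₃ : Integrable fun x => h x * g (x - ε) :=
    (hgi.comp_sub_right ε).bdd_mul hhm (ae_of_all _ hbd)
  -- Discrete integration by parts: translation invariance moves the shift from `h` to `g`, so no
  -- Stieltjes measure is needed.
  have key : ∫ x, ε⁻¹ • (h (x + ε • 1) - h x) * g x =
      ε⁻¹ * ∫ x, h x * (g (x - ε) - g x) := by
    simp only [smul_eq_mul, mul_one, mul_assoc, integral_const_mul]
    congr 1
    simp only [sub_mul, mul_sub]
    rw [integral_sub i₂ i₁, integral_sub i₃ i₁,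
      ← integral_sub_right_eq_self (fun x => h (x + ε) * g x) ε]
    simp only [sub_add_cancel]
  rw [key]
  refine mul_nonneg (inv_nonneg.2 hε.1.le) (integral_nonneg fun x => ?_)
  rcases le_total x 0 with hx | hx
  · simp [h₀ x hx]
  rcases le_total 1 x with hx' | hx'
  · simp [h₁ x hx']
  refine mul_nonneg (hpos x) (sub_nonneg.2 ?_)
  rw [hg, indicator_of_mem (by constructor <;> linarith),
    indicator_of_mem (by constructor <;> linarith [hε.1, hε.2])]
  exact hG (by linarith [hε.1])

/-! ### Passing from [0,1] to the real line -/

/-- The extension of `f : [0,1] → ℝ` to `ℝ` by its boundary values. -/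
noncomputable def unitExtend (f : ℝ → ℝ) (t : ℝ) : ℝ := f (projIcc 0 1 zero_le_one t)

lemma unitExtend_of_mem (f : ℝ → ℝ) {t : ℝ} (ht : t ∈ Icc (0 : ℝ) 1) : unitExtend f t = f t := by
  rw [unitExtend, projIcc_of_mem _ ht]

lemma unitExtend_of_le (f : ℝ → ℝ) {t : ℝ} (ht : t ≤ 0) : unitExtend f t = f 0 := by
  rw [unitExtend, projIcc_of_le_left _ ht]

lemma unitExtend_of_ge (f : ℝ → ℝ) {t : ℝ} (ht : 1 ≤ t) : unitExtend f t = f 1 := by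
  rw [unitExtend, projIcc_of_right_le _ ht]

lemma LipschitzOnWith.unitExtend {K : NNReal} {f : ℝ → ℝ} (hf : LipschitzOnWith K f (Icc 0 1)) :
    LipschitzWith K (unitExtend f) := by
  have := (hf.to_restrict).comp (LipschitzWith.projIcc (zero_le_one (α := ℝ)))
  rwa [mul_one] at this

lemma MonotoneOn.unitExtend {f : ℝ → ℝ} (hf : MonotoneOn f (Icc 0 1)) :
    Monotone (unitExtend f) := fun _ _ hst =>
  hf (projIcc _ _ _ _).2 (projIcc _ _ _ _).2 (monotone_projIcc _ hst)

/-- At the end points the two derivatives may differ, which costs only a null set. -/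
lemma derivWithin_eq_deriv_unitExtend (f : ℝ → ℝ) {t : ℝ} (ht : t ∈ Ioo (0 : ℝ) 1) :
    derivWithin f (Icc 0 1) t = deriv (unitExtend f) t := by
  rw [← derivWithin_of_mem_nhds (Icc_mem_nhds ht.1 ht.2)]
  exact derivWithin_congr (fun x hx => (unitExtend_of_mem f hx).symm)
    (unitExtend_of_mem f (Ioo_subset_Icc_self ht)).symm

lemma derivWithin_ae_eq_deriv_unitExtend (f : ℝ → ℝ) :
    ∀ᵐ t : ℝ, t ∈ Ioc (0 : ℝ) 1 → derivWithin f (Icc 0 1) t = deriv (unitExtend f) t := by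
  filter_upwards [compl_mem_ae_iff.2 (measure_singleton (μ := volume) (1 : ℝ))] with t ht ht'
  exact derivWithin_eq_deriv_unitExtend f ⟨ht'.1, lt_of_le_of_ne ht'.2 ht⟩

lemma LipschitzWith.integral_deriv {K : NNReal} {F : ℝ → ℝ} (hF : LipschitzWith K F) (a b : ℝ) :
    ∫ t in a..b, deriv F t = F b - F a :=
  (hF.lipschitzOnWith (s := uIcc a b)).absolutelyContinuousOnInterval.integral_deriv_eq_sub

/-! ### Convexity and a.e. monotone derivatives -/

/-- A function whose derivative agrees a.e. with an increasing function on `[0,1]` is convex. -/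
lemma convexOn_of_deriv_ae_eq_monotone {K : NNReal} {f G : ℝ → ℝ}
    (hf : LipschitzOnWith K f (Icc 0 1)) (hG : Monotone G)
    (hfG : ∀ᵐ t : ℝ, t ∈ Ioc (0 : ℝ) 1 → deriv (unitExtend f) t = G t) :
    ConvexOn ℝ (Icc 0 1) f := by
  have hint : ∀ a ∈ Icc (0 : ℝ) 1, ∀ b ∈ Icc (0 : ℝ) 1, a ≤ b → f b - f a = ∫ t in a..b, G t := by
    intro a ha b hb hab
    rw [← unitExtend_of_mem f ha, ← unitExtend_of_mem f hb, ← hf.unitExtend.integral_deriv]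
    refine intervalIntegral.integral_congr_ae ?_
    filter_upwards [hfG] with t ht htab
    rw [uIoc_of_le hab] at htab
    exact ht ⟨ha.1.trans_lt htab.1, htab.2.trans hb.2⟩
  refine convexOn_of_slope_mono_adjacent (convex_Icc 0 1) fun {x y z} hx hz hxy hyz => ?_
  have hy : y ∈ Icc (0 : ℝ) 1 := ⟨hx.1.trans hxy.le, hyz.le.trans hz.2⟩
  -- `G y` separates the adjacent slopes, which are the means of `G` over [x,y] and [y,z].
  have h1 : (f y - f x) / (y - x) ≤ G y := by
    rw [div_le_iff₀ (sub_pos.2 hxy), hint x hx y hy hxy.le]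
    have := intervalIntegral.integral_mono_on hxy.le (hG.intervalIntegrable (μ := volume))
      (intervalIntegrable_const (c := G y)) fun t ht => hG ht.2
    rwa [intervalIntegral.integral_const, smul_eq_mul, mul_comm] at this
  have h2 : G y ≤ (f z - f y) / (z - y) := by
    rw [le_div_iff₀ (sub_pos.2 hyz), hint y hy z hz hyz.le]
    have := intervalIntegral.integral_mono_on hyz.le (intervalIntegrable_const (c := G y))
      (hG.intervalIntegrable (μ := volume)) fun t ht => hG ht.1
    rwa [intervalIntegral.integral_const, smul_eq_mul, mul_comm] at this
  exact h1.trans h2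

/-- The Lipschitz constant bounds the derivative on the open interval, and a bounded monotone
function on a subset of ℝ extends monotonically to ℝ. -/
lemma exists_monotone_ae_eq_deriv {K : NNReal} {f : ℝ → ℝ} (hf : LipschitzOnWith K f (Icc 0 1))
    {N : Set ℝ} (hN : volume N = 0)
    (hmono : MonotoneOn (derivWithin f (Icc 0 1)) (Icc 0 1 \ N)) :
    ∃ G : ℝ → ℝ, Monotone G ∧
      ∀ᵐ t : ℝ, t ∈ Ioc (0 : ℝ) 1 → deriv (unitExtend f) t = G t := by
  have hbd : ∀ t ∈ Ioo (0 : ℝ) 1, |derivWithin f (Icc 0 1) t| ≤ K := fun t ht => by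
    rw [derivWithin_eq_deriv_unitExtend f ht]
    exact norm_deriv_le_of_lipschitz hf.unitExtend
  obtain ⟨G, hG, hEq⟩ := (hmono.mono
    (sdiff_subset_sdiff_left (Ioo_subset_Icc_self (a := (0 : ℝ)) (b := 1)))).exists_monotone_extension
    ⟨-K, by rintro _ ⟨t, ht, rfl⟩; exact (abs_le.1 (hbd t ht.1)).1⟩
    ⟨K, by rintro _ ⟨t, ht, rfl⟩; exact (abs_le.1 (hbd t ht.1)).2⟩
  refine ⟨G, hG, ?_⟩
  filter_upwards [compl_mem_ae_iff.2 (measure_singleton (μ := volume) (1 : ℝ)),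
    compl_mem_ae_iff.2 hN] with t ht htN ht'
  have ht'' : t ∈ Ioo (0 : ℝ) 1 := ⟨ht'.1, lt_of_le_of_ne ht'.2 ht⟩
  rw [← derivWithin_eq_deriv_unitExtend f ht'']
  exact hEq ⟨ht'', htN⟩

/-- At two points of differentiability the chord slope lies between the derivatives; Lipschitz
functions are differentiable a.e. -/
lemma ConvexOn.exists_null_monotoneOn_derivWithin {K : NNReal} {f : ℝ → ℝ}
    (hf : LipschitzOnWith K f (Icc 0 1)) (hc : ConvexOn ℝ (Icc 0 1) f) :
    ∃ N : Set ℝ, volume N = 0 ∧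
      (∀ u ∈ Icc (0 : ℝ) 1 \ N, DifferentiableWithinAt ℝ f (Icc 0 1) u) ∧
      MonotoneOn (derivWithin f (Icc 0 1)) (Icc 0 1 \ N) := by
  have hdiff : ∀ u ∈ Icc (0 : ℝ) 1 \ {u | ¬ (u ∈ Icc (0 : ℝ) 1 →
      DifferentiableWithinAt ℝ f (Icc 0 1) u)}, DifferentiableWithinAt ℝ f (Icc 0 1) u :=
    fun u hu => not_not.1 hu.2 hu.1
  refine ⟨_, ae_iff.1 hf.ae_differentiableWithinAt_of_mem_real, hdiff, fun x hx y hy hxy => ?_⟩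
  rcases hxy.eq_or_lt with rfl | hlt
  · rfl
  · exact (hc.derivWithin_le_slope hx.1 hy.1 hlt (hdiff x hx)).trans
      (hc.slope_le_derivWithin hx.1 hy.1 hlt (hdiff y hy))

lemma LipschitzWith.intervalIntegrable_deriv_mul {K : NNReal} {F G : ℝ → ℝ} {a b : ℝ}
    (hF : LipschitzWith K F) (hG : IntervalIntegrable G volume a b) :
    IntervalIntegrable (fun t => deriv F t * G t) volume a b :=
  ⟨hG.1.bdd_mul (measurable_deriv F).aestronglyMeasurable
      (ae_of_all _ fun _ => norm_deriv_le_of_lipschitz hF),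
    hG.2.bdd_mul (measurable_deriv F).aestronglyMeasurable
      (ae_of_all _ fun _ => norm_deriv_le_of_lipschitz hF)⟩

lemma LipschitzWith.intervalIntegrable_deriv {K : NNReal} {F : ℝ → ℝ} {a b : ℝ}
    (hF : LipschitzWith K F) : IntervalIntegrable (deriv F) volume a b := by
  simpa using hF.intervalIntegrable_deriv_mul (intervalIntegrable_const (c := (1 : ℝ)))

lemma LipschitzWith.ae_deriv_le_of_monotone_sub {K L : NNReal} {F H : ℝ → ℝ}
    (hF : LipschitzWith K F) (hH : LipschitzWith L H) (hmono : Monotone (H - F)) :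
    ∀ᵐ t, deriv F t ≤ deriv H t := by
  filter_upwards [hF.ae_differentiableAt_real, hH.ae_differentiableAt_real] with t hFt hHt
  have := hmono.deriv_nonneg (x := t)
  rw [deriv_sub hHt hFt] at this
  exact sub_nonneg.1 this

/-! ### Regularity of copulas -/

namespace IsCopula

variable {C : ℝ → ℝ → ℝ}

lemma swap (hC : IsCopula C) : IsCopula (fun u v => C v u) where
  zero_left := hC.zero_right
  zero_right := hC.zero_left
  one_left := hC.one_right
  one_right := hC.one_left
  two_increasing u₁ hu₁ u₂ hu₂ v₁ hv₁ v₂ hv₂ hu hv := by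
    have := hC.two_increasing v₁ hv₁ v₂ hv₂ u₁ hu₁ u₂ hu₂ hv hu
    linarith

lemma monotoneOn_sub (hC : IsCopula C) {v₁ v₂ : ℝ} (hv₁ : v₁ ∈ Icc (0 : ℝ) 1)
    (hv₂ : v₂ ∈ Icc (0 : ℝ) 1) (hv : v₁ ≤ v₂) :
    MonotoneOn ((fun s => C s v₂) - fun s => C s v₁) (Icc 0 1) := fun x hx y hy hxy => by
  have := hC.two_increasing x hx y hy v₁ hv₁ v₂ hv₂ hxy hv
  simp only [Pi.sub_apply]
  linarith

lemma monotoneOn (hC : IsCopula C) {v : ℝ} (hv : v ∈ Icc (0 : ℝ) 1) :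
    MonotoneOn (fun s => C s v) (Icc 0 1) := fun x hx y hy hxy => by
  have := hC.two_increasing x hx y hy 0 (by simp) v hv hxy hv.1
  rw [hC.zero_right x hx, hC.zero_right y hy] at this
  simp only
  linarith

lemma lipschitzOnWith (hC : IsCopula C) {v : ℝ} (hv : v ∈ Icc (0 : ℝ) 1) :
    LipschitzOnWith 1 (fun s => C s v) (Icc 0 1) := by
  refine LipschitzOnWith.of_le_add_mul 1 fun x hx y hy => ?_
  rw [NNReal.coe_one, one_mul, Real.dist_eq]
  rcases le_total x y with hxy | hxy
  · exact (hC.monotoneOn hv hx hy hxy).trans (le_add_of_nonneg_right (abs_nonneg _))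
  -- Comparison with the margin C(x,1) = x bounds the growth in the first argument.
  · have := hC.two_increasing y hy x hx v hv 1 (by simp) hxy hv.2
    rw [hC.one_right x hx, hC.one_right y hy] at this
    rw [abs_of_nonneg (sub_nonneg.2 hxy)]
    linarith

end IsCopula

/-! ### The Markov product -/

section

variable {C₁ C₂ : ℝ → ℝ → ℝ}

lemma markovProduct_eq_integral (C₁ C₂ : ℝ → ℝ → ℝ) (u v : ℝ) :
    markovProduct C₁ C₂ u v = ∫ t in (0 : ℝ)..1,
      deriv (unitExtend (C₁ u)) t * deriv (unitExtend fun s => C₂ s v) t := by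
  refine intervalIntegral.integral_congr_ae ?_
  filter_upwards [derivWithin_ae_eq_deriv_unitExtend (C₁ u),
    derivWithin_ae_eq_deriv_unitExtend fun s => C₂ s v] with t h₁ h₂ ht
  rw [uIoc_of_le zero_le_one] at ht
  rw [← h₁ ht, ← h₂ ht]
  rfl

lemma unitExtend_eq_const {f : ℝ → ℝ} {c : ℝ} (hf : ∀ t ∈ Icc (0 : ℝ) 1, f t = c) :
    unitExtend f = fun _ => c :=
  funext fun _ => hf _ (projIcc _ _ _ _).2

lemma deriv_unitExtend_of_eq_id {f : ℝ → ℝ} (hf : ∀ t ∈ Icc (0 : ℝ) 1, f t = t) :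
    ∀ᵐ t : ℝ, t ∈ Ioc (0 : ℝ) 1 → deriv (unitExtend f) t = 1 := by
  filter_upwards [compl_mem_ae_iff.2 (measure_singleton (μ := volume) (1 : ℝ))] with t ht ht'
  have hev : unitExtend f =ᶠ[nhds t] id := by
    filter_upwards [Icc_mem_nhds ht'.1 (lt_of_le_of_ne ht'.2 ht)] with x hx
    rw [unitExtend_of_mem f hx, hf x hx, id]
  rw [hev.deriv_eq, deriv_id]

theorem IsCopula.isCopula_markovProduct (hC₁ : IsCopula C₁) (hC₂ : IsCopula C₂) :
    IsCopula (markovProduct C₁ C₂) where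
  zero_left v hv := by
    rw [markovProduct_eq_integral, unitExtend_eq_const hC₁.zero_left]
    simp
  zero_right u hu := by
    rw [markovProduct_eq_integral, unitExtend_eq_const hC₂.zero_right]
    simp
  one_left v hv := by
    have h : ∫ t in (0 : ℝ)..1, deriv (unitExtend fun s => C₂ s v) t = v := by
      rw [(hC₂.lipschitzOnWith hv).unitExtend.integral_deriv, unitExtend_of_le _ le_rfl,
        unitExtend_of_ge _ le_rfl, hC₂.one_left v hv, hC₂.zero_left v hv, sub_zero]
    rw [markovProduct_eq_integral]
    refine (intervalIntegral.integral_congr_ae ?_).trans h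
    filter_upwards [deriv_unitExtend_of_eq_id hC₁.one_left] with t h₁ ht
    rw [uIoc_of_le zero_le_one] at ht
    rw [h₁ ht, one_mul]
  one_right u hu := by
    have h : ∫ t in (0 : ℝ)..1, deriv (unitExtend (C₁ u)) t = u := by
      rw [(hC₁.swap.lipschitzOnWith hu).unitExtend.integral_deriv, unitExtend_of_le _ le_rfl,
        unitExtend_of_ge _ le_rfl, hC₁.one_right u hu, hC₁.zero_right u hu, sub_zero]
    rw [markovProduct_eq_integral]
    refine (intervalIntegral.integral_congr_ae ?_).trans h
    filter_upwards [deriv_unitExtend_of_eq_id hC₂.one_right] with t h₁ ht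
    rw [uIoc_of_le zero_le_one] at ht
    rw [h₁ ht, mul_one]
  two_increasing u₁ hu₁ u₂ hu₂ v₁ hv₁ v₂ hv₂ hu hv := by
    have hF₁ := (hC₁.swap.lipschitzOnWith hu₁).unitExtend
    have hF₂ := (hC₁.swap.lipschitzOnWith hu₂).unitExtend
    have hH₁ := (hC₂.lipschitzOnWith hv₁).unitExtend
    have hH₂ := (hC₂.lipschitzOnWith hv₂).unitExtend
    have i := fun {F G : ℝ → ℝ} (hF : LipschitzWith 1 F) (hG : LipschitzWith 1 G) =>
      hF.intervalIntegrable_deriv_mul (a := 0) (b := 1) hG.intervalIntegrable_deriv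
    simp only [markovProduct_eq_integral]
    rw [← intervalIntegral.integral_sub (i hF₂ hH₂) (i hF₂ hH₁),
      ← intervalIntegral.integral_sub ((i hF₂ hH₂).sub (i hF₂ hH₁)) (i hF₁ hH₂),
      ← intervalIntegral.integral_add (((i hF₂ hH₂).sub (i hF₂ hH₁)).sub (i hF₁ hH₂)) (i hF₁ hH₁)]
    -- The integrand factors as an increment of ∂₂C₁ in u times an increment of ∂₁C₂ in v, both
    -- nonnegative a.e.
    refine intervalIntegral.integral_nonneg_of_ae zero_le_one ?_
    filter_upwards [hF₁.ae_deriv_le_of_monotone_sub hF₂ (hC₁.swap.monotoneOn_sub hu₁ hu₂ hu).unitExtend,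
      hH₁.ae_deriv_le_of_monotone_sub hH₂ (hC₂.monotoneOn_sub hv₁ hv₂ hv).unitExtend] with t h₁ h₂
    have := mul_nonneg (sub_nonneg.2 h₁) (sub_nonneg.2 h₂)
    simp only [Pi.zero_apply]
    linarith

lemma IsCopula.lipschitzOnWith_mul (hC : IsCopula C₁) (σ : ℝ) {v : ℝ} (hv : v ∈ Icc (0 : ℝ) 1) :
    ∃ K : NNReal, LipschitzOnWith K (fun s => σ * C₁ s v) (Icc 0 1) :=
  ⟨_, (lipschitzWith_smul σ).comp_lipschitzOnWith (hC.lipschitzOnWith hv)⟩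

/-- The factor 1 matches the form σ * C with σ = ±1 used for the product. -/
lemma IsCopula.stochasticallyDecreasing_iff (hC : IsCopula C₁) :
    StochasticallyDecreasing C₁ ↔
      ∀ v ∈ Icc (0 : ℝ) 1, ConvexOn ℝ (Icc 0 1) fun s => 1 * C₁ s v := by
  refine forall₂_congr fun v hv => ?_
  simp only [one_mul]
  have hL := hC.lipschitzOnWith hv
  refine ⟨fun ⟨N, hN, _, hmono⟩ => ?_, fun h => h.exists_null_monotoneOn_derivWithin hL⟩
  obtain ⟨G, hG, hEq⟩ := exists_monotone_ae_eq_deriv hL hN hmono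
  exact convexOn_of_deriv_ae_eq_monotone hL hG hEq

lemma IsCopula.stochasticallyIncreasing_iff (hC : IsCopula C₁) :
    StochasticallyIncreasing C₁ ↔
      ∀ v ∈ Icc (0 : ℝ) 1, ConvexOn ℝ (Icc 0 1) fun s => -1 * C₁ s v := by
  refine forall₂_congr fun v hv => ?_
  obtain ⟨K, hL⟩ := hC.lipschitzOnWith_mul (-1) hv
  have hneg : derivWithin (fun s => -1 * C₁ s v) (Icc 0 1) = fun u => -copulaPartialFst C₁ u v := by
    ext u
    rw [derivWithin_const_mul_field, neg_one_mul]
    rfl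
  constructor
  · rintro ⟨N, hN, _, hanti⟩
    obtain ⟨G, hG, hEq⟩ := exists_monotone_ae_eq_deriv hL hN (hneg ▸ hanti.neg)
    exact convexOn_of_deriv_ae_eq_monotone hL hG hEq
  · intro h
    obtain ⟨N, hN, hdiff, hmono⟩ := h.exists_null_monotoneOn_derivWithin hL
    refine ⟨N, hN, fun u hu => ?_, fun x hx y hy hxy => ?_⟩
    · simpa using (hdiff u hu).neg
    · rw [hneg] at hmono
      exact neg_le_neg_iff.1 (hmono hx hy hxy)

/-- If `σ C₁` and `τ C₂` are convex in the first component, then so is `-σ τ (C₁ * C₂)`. -/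
theorem IsCopula.convexOn_markovProduct (hC₁ : IsCopula C₁) (hC₂ : IsCopula C₂) {σ τ : ℝ}
    (h₁ : ∀ v ∈ Icc (0 : ℝ) 1, ConvexOn ℝ (Icc 0 1) fun s => σ * C₁ s v)
    (h₂ : ∀ v ∈ Icc (0 : ℝ) 1, ConvexOn ℝ (Icc 0 1) fun s => τ * C₂ s v)
    {v : ℝ} (hv : v ∈ Icc (0 : ℝ) 1) :
    ConvexOn ℝ (Icc 0 1) fun s => -(σ * τ) * markovProduct C₁ C₂ s v := by
  obtain ⟨K, hL⟩ := hC₂.lipschitzOnWith_mul τ hv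
  obtain ⟨N, hN, -, hmono⟩ := (h₂ v hv).exists_null_monotoneOn_derivWithin hL
  obtain ⟨G, hG, hEq⟩ := exists_monotone_ae_eq_deriv hL hN hmono
  have hτ : ∀ t, deriv (unitExtend fun s => τ * C₂ s v) t =
      τ * deriv (unitExtend fun s => C₂ s v) t := fun t => deriv_const_mul_field τ
  refine ⟨convex_Icc 0 1, fun x hx y hy a b ha hb hab => ?_⟩
  have hz : a * x + b * y ∈ Icc (0 : ℝ) 1 := convex_Icc 0 1 hx hy ha hb hab
  simp only [smul_eq_mul]
  set z := a * x + b * y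
  have hx' := (hC₁.swap.lipschitzOnWith hx).unitExtend
  have hy' := (hC₁.swap.lipschitzOnWith hy).unitExtend
  have hz' := (hC₁.swap.lipschitzOnWith hz).unitExtend
  have hG' := (hC₂.lipschitzOnWith hv).unitExtend
  have i := fun {F : ℝ → ℝ} (hF : LipschitzWith 1 F) =>
      hF.intervalIntegrable_deriv_mul (a := 0) (b := 1) hG'.intervalIntegrable_deriv
  set h : ℝ → ℝ := fun t => σ * (a * unitExtend (C₁ x) t + b * unitExtend (C₁ y) t
    - unitExtend (C₁ z) t) with hh
  obtain ⟨L, hLh⟩ : ∃ L, LipschitzWith L h := by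
    exact ⟨_, (lipschitzWith_smul σ).comp ((((lipschitzWith_smul a).comp hx').add
      ((lipschitzWith_smul b).comp hy')).sub hz')⟩
  have hpos : ∀ t, 0 ≤ h t := fun t => by
    have := (h₁ _ (projIcc 0 1 zero_le_one t).2).2 hx hy ha hb hab
    simp only [smul_eq_mul] at this
    simp only [hh, unitExtend]
    linarith
  have hzero : ∀ t ≤ 0, h t = 0 := fun t ht => by
    simp only [hh, unitExtend_of_le _ ht, hC₁.zero_right x hx, hC₁.zero_right y hy,
      hC₁.zero_right z hz]
    ring
  -- The margin C₁(u,1) = u is affine in u, so its convexity defect is zero.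
  have hone : ∀ t, 1 ≤ t → h t = 0 := fun t ht => by
    simp only [hh, unitExtend_of_ge _ ht, hC₁.one_right x hx, hC₁.one_right y hy,
      hC₁.one_right z hz]
    simp [z]
  have key := integral_deriv_mul_antitone_nonneg hLh hpos hzero hone hG.neg
  have hint : ∫ t in (0 : ℝ)..1, deriv h t * -G t =
      -(σ * τ) * (a * markovProduct C₁ C₂ x v + b * markovProduct C₁ C₂ y v
        - markovProduct C₁ C₂ z v) := by
    simp only [markovProduct_eq_integral]
    rw [← intervalIntegral.integral_const_mul, ← intervalIntegral.integral_const_mul,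
      ← intervalIntegral.integral_add ((i hx').const_mul a) ((i hy').const_mul b),
      ← intervalIntegral.integral_sub (((i hx').const_mul a).add ((i hy').const_mul b)) (i hz'),
      ← intervalIntegral.integral_const_mul]
    refine intervalIntegral.integral_congr_ae ?_
    filter_upwards [hEq, hx'.ae_differentiableAt_real, hy'.ae_differentiableAt_real,
      hz'.ae_differentiableAt_real] with t hGt hxt hyt hzt ht
    rw [uIoc_of_le zero_le_one] at ht
    have hd : HasDerivAt h (σ * (a * deriv (unitExtend (C₁ x)) t + b * deriv (unitExtend (C₁ y)) t
        - deriv (unitExtend (C₁ z)) t)) t :=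
      (((hxt.hasDerivAt.const_mul a).add (hyt.hasDerivAt.const_mul b)).sub
        hzt.hasDerivAt).const_mul σ
    rw [hd.deriv, ← hGt ht, hτ]
    ring
  rw [hint] at key
  linarith

end

theorem mainTheorem5 (C₁ C₂ : ℝ → ℝ → ℝ) (hC₁ : IsCopula C₁) (hC₂ : IsCopula C₂)
    (hmon₁ : StochasticallyMonotone C₁) (hmon₂ : StochasticallyMonotone C₂) :
    IsCopula (markovProduct C₁ C₂) ∧
    StochasticallyMonotone (markovProduct C₁ C₂) ∧
    ((StochasticallyIncreasing C₁ ∧ StochasticallyIncreasing C₂) ∨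
        (StochasticallyDecreasing C₁ ∧ StochasticallyDecreasing C₂) →
      StochasticallyIncreasing (markovProduct C₁ C₂)) ∧
    ((StochasticallyIncreasing C₁ ∧ StochasticallyDecreasing C₂) ∨
        (StochasticallyDecreasing C₁ ∧ StochasticallyIncreasing C₂) →
      StochasticallyDecreasing (markovProduct C₁ C₂)) := by
  have hC := hC₁.isCopula_markovProduct hC₂
  have hinc : (StochasticallyIncreasing C₁ ∧ StochasticallyIncreasing C₂) ∨
      (StochasticallyDecreasing C₁ ∧ StochasticallyDecreasing C₂) →
      StochasticallyIncreasing (markovProduct C₁ C₂) := by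
    rw [hC₁.stochasticallyIncreasing_iff, hC₁.stochasticallyDecreasing_iff,
      hC₂.stochasticallyIncreasing_iff, hC₂.stochasticallyDecreasing_iff,
      hC.stochasticallyIncreasing_iff]
    rintro (⟨h₁, h₂⟩ | ⟨h₁, h₂⟩) v hv <;>
      simpa using hC₁.convexOn_markovProduct hC₂ h₁ h₂ hv
  have hdec : (StochasticallyIncreasing C₁ ∧ StochasticallyDecreasing C₂) ∨
      (StochasticallyDecreasing C₁ ∧ StochasticallyIncreasing C₂) →
      StochasticallyDecreasing (markovProduct C₁ C₂) := by
    rw [hC₁.stochasticallyIncreasing_iff, hC₁.stochasticallyDecreasing_iff,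
      hC₂.stochasticallyIncreasing_iff, hC₂.stochasticallyDecreasing_iff,
      hC.stochasticallyDecreasing_iff]
    rintro (⟨h₁, h₂⟩ | ⟨h₁, h₂⟩) v hv <;>
      simpa using hC₁.convexOn_markovProduct hC₂ h₁ h₂ hv
  refine ⟨hC, ?_, hinc, hdec⟩
  rcases hmon₁ with h₁ | h₁ <;> rcases hmon₂ with h₂ | h₂
  · exact Or.inl (hinc (Or.inl ⟨h₁, h₂⟩))
  · exact Or.inr (hdec (Or.inl ⟨h₁, h₂⟩))
  · exact Or.inr (hdec (Or.inr ⟨h₁, h₂⟩))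
  · exact Or.inl (hinc (Or.inr ⟨h₁, h₂⟩))
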